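/- Let $k$ be a field and let $q\in k$ be nonzero of infinite multiplicative order, i.e. $q^n\neq 1$ for all $n\ge 1$. Let $$\Lambda = k\langle x,y,z\rangle/(x^2,\ y^2,\ z^2,\ yz,\ xy+q\,yx,\ xz-zx,\ zy-zx),$$ and let $M(q)$ be the left $\Lambda$-module with $k$-basis $v,v',v''$ and action $xv=q\,v'$, $yv=v'$, $zv=v''$, $xv'=yv'=zv'=xv''=yv''=zv''=0$. Regard $M(q)$ as a $\Lambda$-$k$-bimodule, and $D(M(q))=\operatorname{Hom}_k(M(q),k)$ as a $k$-$\Lambda$-bimodule via $(f\cdot a)(m)=f(am)$. Then the one-point extension and the one-point coextension $$B=\begin{pmatrix} k & 0\\ M(q) & \Lambda\end{pmatrix},\qquad C=\begin{pmatrix}\Lambda & 0\\ D(M(q)) & k\end{pmatrix}$$ are derived equivalent: there is a triangulated equivalence $D^b(B\text{-}\mathrm{Mod})\simeq D^b(C\text{-}\mathrm{Mod})$ between the bounded derived categories of the categories of all left modules. -/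

import Mathlib

open CategoryTheory

universe w w' u

/-! ### Triangular matrix rings -/

/-- The lower triangular matrix ring `[[R, 0], [N, S]]` of an `S`-`R`-bimodule `N`
(a left `S`-module and right `R`-module with commuting actions).  An element is the matrix
`[[a₁₁, 0], [a₂₁, a₂₂]]`. -/
@[ext]
structure LowerTriangular (R S N : Type*) where
  a₁₁ : R
  a₂₁ : N
  a₂₂ : S

namespace LowerTriangular

variable {R S N : Type*} [Ring R] [Ring S] [AddCommGroup N]

instance : Zero (LowerTriangular R S N) := ⟨⟨0, 0, 0⟩⟩
instance : One (LowerTriangular R S N) := ⟨⟨1, 0, 1⟩⟩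
instance : Add (LowerTriangular R S N) := ⟨fun a b => ⟨a.a₁₁ + b.a₁₁, a.a₂₁ + b.a₂₁, a.a₂₂ + b.a₂₂⟩⟩
instance : Neg (LowerTriangular R S N) := ⟨fun a => ⟨-a.a₁₁, -a.a₂₁, -a.a₂₂⟩⟩

@[simp] lemma zero_a₁₁ : (0 : LowerTriangular R S N).a₁₁ = 0 := rfl
@[simp] lemma zero_a₂₁ : (0 : LowerTriangular R S N).a₂₁ = 0 := rfl
@[simp] lemma zero_a₂₂ : (0 : LowerTriangular R S N).a₂₂ = 0 := rfl
@[simp] lemma one_a₁₁ : (1 : LowerTriangular R S N).a₁₁ = 1 := rfl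
@[simp] lemma one_a₂₁ : (1 : LowerTriangular R S N).a₂₁ = 0 := rfl
@[simp] lemma one_a₂₂ : (1 : LowerTriangular R S N).a₂₂ = 1 := rfl
@[simp] lemma add_a₁₁ (a b : LowerTriangular R S N) : (a + b).a₁₁ = a.a₁₁ + b.a₁₁ := rfl
@[simp] lemma add_a₂₁ (a b : LowerTriangular R S N) : (a + b).a₂₁ = a.a₂₁ + b.a₂₁ := rfl
@[simp] lemma add_a₂₂ (a b : LowerTriangular R S N) : (a + b).a₂₂ = a.a₂₂ + b.a₂₂ := rfl
@[simp] lemma neg_a₁₁ (a : LowerTriangular R S N) : (-a).a₁₁ = -a.a₁₁ := rfl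
@[simp] lemma neg_a₂₁ (a : LowerTriangular R S N) : (-a).a₂₁ = -a.a₂₁ := rfl
@[simp] lemma neg_a₂₂ (a : LowerTriangular R S N) : (-a).a₂₂ = -a.a₂₂ := rfl
variable [Module S N] [Module Rᵐᵒᵖ N]

/-- Matrix multiplication; the lower left entry of the product is `a₂₁ b₁₁ + a₂₂ b₂₁`. -/
instance : Mul (LowerTriangular R S N) :=
  ⟨fun a b => ⟨a.a₁₁ * b.a₁₁, MulOpposite.op b.a₁₁ • a.a₂₁ + a.a₂₂ • b.a₂₁, a.a₂₂ * b.a₂₂⟩⟩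

@[simp] lemma mul_a₁₁ (a b : LowerTriangular R S N) : (a * b).a₁₁ = a.a₁₁ * b.a₁₁ := rfl
@[simp] lemma mul_a₂₁ (a b : LowerTriangular R S N) :
    (a * b).a₂₁ = MulOpposite.op b.a₁₁ • a.a₂₁ + a.a₂₂ • b.a₂₁ := rfl
@[simp] lemma mul_a₂₂ (a b : LowerTriangular R S N) : (a * b).a₂₂ = a.a₂₂ * b.a₂₂ := rfl

instance [SMulCommClass S Rᵐᵒᵖ N] : Ring (LowerTriangular R S N) where
  add_assoc _ _ _ := by ext <;> simp [add_assoc]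
  zero_add _ := by ext <;> simp
  add_zero _ := by ext <;> simp
  add_comm _ _ := by ext <;> simp [add_comm]
  neg_add_cancel _ := by ext <;> simp
  mul_assoc _ _ _ := by
    ext <;> simp [mul_assoc, mul_smul, add_assoc, smul_comm]
  one_mul _ := by ext <;> simp
  mul_one _ := by ext <;> simp
  left_distrib _ _ _ := by
    ext <;> simp only [mul_a₁₁, mul_a₂₁, mul_a₂₂, add_a₁₁, add_a₂₁, add_a₂₂, mul_add, smul_add,
      add_smul, MulOpposite.op_add]
    abel
  right_distrib _ _ _ := by
    ext <;> simp only [mul_a₁₁, mul_a₂₁, mul_a₂₂, add_a₁₁, add_a₂₁, add_a₂₂, add_mul, smul_add,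
      add_smul]
    abel
  zero_mul _ := by ext <;> simp
  mul_zero _ := by ext <;> simp
  nsmul := nsmulRec
  zsmul := zsmulRec

/-- If `R`, `S` are `k`-algebras and `k` acts on `N` compatibly, the triangular matrix ring is a
`k`-algebra, with entrywise scalar multiplication. -/
instance {k : Type*} [CommRing k] [Algebra k R] [Algebra k S] [Module k N] [IsScalarTower k S N]
    [IsScalarTower k Rᵐᵒᵖ N] [SMulCommClass S Rᵐᵒᵖ N] : Algebra k (LowerTriangular R S N) where
  smul c a := ⟨c • a.a₁₁, c • a.a₂₁, c • a.a₂₂⟩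
  algebraMap :=
    { toFun := fun c => ⟨algebraMap k R c, 0, algebraMap k S c⟩
      map_one' := by ext <;> simp
      map_mul' := fun c d => by ext <;> simp
      map_zero' := by ext <;> simp
      map_add' := fun c d => by ext <;> simp }
  commutes' c a := by
    ext
    · exact Algebra.commutes c a.a₁₁
    · have h : MulOpposite.op (algebraMap k R c) = c • (1 : Rᵐᵒᵖ) := by
        rw [Algebra.algebraMap_eq_smul_one, MulOpposite.op_smul, MulOpposite.op_one]
      change MulOpposite.op a.a₁₁ • (0 : N) + algebraMap k S c • a.a₂₁ =
        MulOpposite.op (algebraMap k R c) • a.a₂₁ + a.a₂₂ • (0 : N)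
      rw [h, algebraMap_smul, smul_assoc, one_smul, smul_zero, smul_zero, zero_add, add_zero]
    · exact Algebra.commutes c a.a₂₂
  smul_def' c a := by
    ext
    · exact Algebra.smul_def c a.a₁₁
    · change c • a.a₂₁ = MulOpposite.op a.a₁₁ • (0 : N) + algebraMap k S c • a.a₂₁
      rw [algebraMap_smul, smul_zero, zero_add]
    · exact Algebra.smul_def c a.a₂₂

end LowerTriangular

/-! ### The local algebra `Λ` and the modules `M(α)` -/

/-- The three generators `x, y, z`. -/
inductive LambdaGen : Type
  | x | y | z

namespace LambdaGen

variable {k : Type u} [Field k]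

/-- The generator `x` of the free algebra `k⟨x, y, z⟩`. -/
abbrev X : FreeAlgebra k LambdaGen := FreeAlgebra.ι k x
/-- The generator `y` of the free algebra `k⟨x, y, z⟩`. -/
abbrev Y : FreeAlgebra k LambdaGen := FreeAlgebra.ι k y
/-- The generator `z` of the free algebra `k⟨x, y, z⟩`. -/
abbrev Z : FreeAlgebra k LambdaGen := FreeAlgebra.ι k z

/-- The defining relations `x², y², z², yz, xy + q yx, xz - zx, zy - zx` of `Λ`. -/
inductive Rel (q : k) : FreeAlgebra k LambdaGen → FreeAlgebra k LambdaGen → Prop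
  | xx : Rel q (X ^ 2) 0
  | yy : Rel q (Y ^ 2) 0
  | zz : Rel q (Z ^ 2) 0
  | yz : Rel q (Y * Z) 0
  | xy : Rel q (X * Y + q • (Y * X)) 0
  | xz : Rel q (X * Z - Z * X) 0
  | zy : Rel q (Z * Y - Z * X) 0

end LambdaGen

section Algebras

variable {k : Type u} [Field k]

/-- `Λ = k⟨x, y, z⟩ / (x², y², z², yz, xy + q yx, xz - zx, zy - zx)`. -/
abbrev LambdaAlg (q : k) : Type u := RingQuot (LambdaGen.Rel q)

/-- The underlying vector space `k³` of `M(α)`, a triple being the coordinates with respect to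
the basis `v, v', v''`. -/
def SpecialModule (_q _α : k) : Type u := Fin 3 → k

namespace SpecialModule

variable (q α : k)

instance : AddCommGroup (SpecialModule q α) := inferInstanceAs (AddCommGroup (Fin 3 → k))
instance : Module k (SpecialModule q α) := inferInstanceAs (Module k (Fin 3 → k))
/-- The right `k`-action, `m · c = c m`. -/
instance : Module kᵐᵒᵖ (SpecialModule q α) := inferInstanceAs (Module kᵐᵒᵖ (Fin 3 → k))
instance : IsCentralScalar k (SpecialModule q α) :=
  inferInstanceAs (IsCentralScalar k (Fin 3 → k))

/-- The linear map sending the basis vectors `v, v', v''` to `a v' + b v'', 0, 0`. -/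
def shiftEnd (a b : k) : Module.End k (SpecialModule q α) where
  toFun m := ![0, a * m 0, b * m 0]
  map_add' m n := by
    change _ = (_ : Fin 3 → k) + _
    have h : (m + n : SpecialModule q α) 0 = m 0 + n 0 := rfl
    funext i; fin_cases i <;> simp [h, mul_add]
  map_smul' c m := by
    change _ = c • (_ : Fin 3 → k)
    have h : (c • m : SpecialModule q α) 0 = c * m 0 := rfl
    funext i; fin_cases i <;> simp [h, mul_left_comm]

lemma shiftEnd_mul (a b c d : k) : shiftEnd q α a b * shiftEnd q α c d = 0 := by
  ext m
  change (![0, a * 0, b * 0] : Fin 3 → k) = 0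
  funext i; fin_cases i <;> simp

/-- The action of the generators on `M(α)`: `x v = α v'`, `y v = v'`, `z v = v''`, and all
generators annihilate `v'` and `v''`. -/
def genAction : LambdaGen → Module.End k (SpecialModule q α)
  | .x => shiftEnd q α α 0
  | .y => shiftEnd q α 1 0
  | .z => shiftEnd q α 0 1

lemma genAction_mul (g h : LambdaGen) : genAction q α g * genAction q α h = 0 := by
  cases g <;> cases h <;> exact shiftEnd_mul q α _ _ _ _

/-- The representation of `Λ` on `M(α)`. -/
noncomputable def action : LambdaAlg q →ₐ[k] Module.End k (SpecialModule q α) :=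
  RingQuot.liftAlgHom k ⟨FreeAlgebra.lift k (genAction q α), by
    intro a b hab
    cases hab <;> simp [pow_two, genAction_mul]⟩

/-- The left `Λ`-module structure of `M(α)`. -/
noncomputable instance : Module (LambdaAlg q) (SpecialModule q α) :=
  Module.compHom _ (action q α).toRingHom

lemma smul_def (a : LambdaAlg q) (m : SpecialModule q α) : a • m = action q α a m := rfl

instance : SMulCommClass (LambdaAlg q) k (SpecialModule q α) :=
  ⟨fun a c m => (action q α a).map_smul c m⟩

instance : SMulCommClass (LambdaAlg q) kᵐᵒᵖ (SpecialModule q α) :=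
  ⟨fun a c m => by
    induction c using MulOpposite.rec' with
    | _ c => rw [op_smul_eq_smul, op_smul_eq_smul, smul_comm]⟩

instance : IsScalarTower k (LambdaAlg q) (SpecialModule q α) :=
  ⟨fun c a m => by
    rw [smul_def, smul_def, map_smul, LinearMap.smul_apply]⟩

instance : IsScalarTower k kᵐᵒᵖ (SpecialModule q α) :=
  inferInstanceAs (IsScalarTower k kᵐᵒᵖ (Fin 3 → k))

end SpecialModule

/-- `D(M(α)) = Hom_k(M(α), k)`. -/
def DualSpecialModule (q α : k) : Type u := Module.Dual k (SpecialModule q α)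

namespace DualSpecialModule

variable (q α : k)

instance : AddCommGroup (DualSpecialModule q α) :=
  inferInstanceAs (AddCommGroup (Module.Dual k (SpecialModule q α)))
instance : Module k (DualSpecialModule q α) :=
  inferInstanceAs (Module k (Module.Dual k (SpecialModule q α)))

/-- The right `Λ`-module structure of `D(M(α))`, `(f · a)(m) = f(a m)`. -/
noncomputable instance : Module (LambdaAlg q)ᵐᵒᵖ (DualSpecialModule q α) where
  smul a f := LinearMap.comp (f : Module.Dual k (SpecialModule q α))
    (SpecialModule.action q α a.unop)
  one_smul f := by
    change LinearMap.comp (f : Module.Dual k (SpecialModule q α))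
      (SpecialModule.action q α 1) = f
    rw [map_one]; rfl
  mul_smul a b f := by
    change LinearMap.comp (f : Module.Dual k (SpecialModule q α))
      (SpecialModule.action q α (b.unop * a.unop)) = _
    rw [map_mul]; rfl
  smul_zero a := LinearMap.zero_comp (SpecialModule.action q α a.unop)
  smul_add a f g := LinearMap.add_comp (SpecialModule.action q α a.unop)
    (g : Module.Dual k (SpecialModule q α)) (f : Module.Dual k (SpecialModule q α))
  add_smul a b f := by
    change LinearMap.comp (f : Module.Dual k (SpecialModule q α))
      (SpecialModule.action q α (a.unop + b.unop)) = _
    rw [map_add]; exact LinearMap.comp_add _ _ _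
  zero_smul f := by
    change LinearMap.comp (f : Module.Dual k (SpecialModule q α))
      (SpecialModule.action q α 0) = _
    rw [map_zero]; exact LinearMap.comp_zero _

instance : SMulCommClass k (LambdaAlg q)ᵐᵒᵖ (DualSpecialModule q α) :=
  ⟨fun c a f => (LinearMap.smul_comp c (f : Module.Dual k (SpecialModule q α))
    (SpecialModule.action q α a.unop)).symm⟩

instance : IsScalarTower k (LambdaAlg q)ᵐᵒᵖ (DualSpecialModule q α) :=
  ⟨fun c a f => by
    change LinearMap.comp (f : Module.Dual k (SpecialModule q α))
      (SpecialModule.action q α (c • a.unop)) = _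
    rw [map_smul]; exact LinearMap.comp_smul _ _ _⟩

end DualSpecialModule

/-- The one-point extension `B = [[k, 0], [M(q), Λ]]`. -/
abbrev AlgB (q : k) : Type u := LowerTriangular k (LambdaAlg q) (SpecialModule q q)

/-- The one-point coextension `C = [[Λ, 0], [D(M(q)), k]]`. -/
abbrev AlgC (q : k) : Type u := LowerTriangular (LambdaAlg q) k (DualSpecialModule q q)

end Algebras

/-! ### Derived equivalence -/

/-- Two rings are derived equivalent if there is a triangulated equivalence
`D^b(A-Mod) ≃ D^b(A'-Mod)` between the bounded derived categories of all left modules. -/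
def DerivedEquivalent (A A' : Type u) [Ring A] [Ring A']
    [HasDerivedCategory.{w} (ModuleCat.{u} A)] [HasDerivedCategory.{w'} (ModuleCat.{u} A')] :
    Prop :=
  ∃ (F : DerivedCategory.Bounded (ModuleCat.{u} A) ⥤ DerivedCategory.Bounded (ModuleCat.{u} A'))
    (_ : F.CommShift ℤ), F.IsEquivalence ∧ F.IsTriangulated

/-! Write `E` for the glued algebra `GluedAlg q`, of lower triangular matrices with diagonal `k, Λ,
k`, and `e_V`, `e_W` for its first and last diagonal idempotents. Killing `e_W` gives the quotient
`B`, killing `e_V` gives the quotient `C`. The corner entry `k`, multiplied through the evaluation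
pairing of `D(M)` and `M`, is chosen so that the last row `e_W E` is the `k`-dual of the first
column `E e_V` (`row_mul`). Since the column is finite-dimensional, the functor `r : U ↦ Hom_k(e_W
E, U)` is also `U ↦ E e_V ⊗ U`. It therefore has the two exact adjoints `N ↦ e_W N` on the left
(`truncationAdjCoind`) and `N ↦ e_V N` on the right (`coindAdjTruncation`), and it is fully faithful
because `e_V E e_V = k`.

All functors involved are exact, so these adjunctions and the full faithfulness pass to derived
categories. In `D(E)` the objects killed by `e_W` are the image of `D(B)` and form the left
orthogonal of the image of `r`; those killed by `e_V` are the image of `D(C)` and form its right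
orthogonal. The two orthogonals of one subcategory that has both adjoints are equivalent, each being
a model of the quotient of `D(E)` by it: an object `X` of the left one is sent to the cone of `r
(e_V X) ⟶ X`. This is `exists_triangulated_equivalence_of_mutation`. The cone triangles preserve
boundedness in both directions, which gives the equivalence of bounded derived categories. -/

namespace CategoryTheory

open Limits

/-! ### Adjunctions of exact functors on derived categories -/

section DerivedAdjunction

variable {C₁ C₂ : Type*} [Category* C₁] [Category* C₂]
  {F : C₁ ⥤ C₂} {G : C₂ ⥤ C₁}

/-- An adjunction between additive functors induces an adjunction on complexes. -/
def Adjunction.mapHomologicalComplex [Preadditive C₁] [Preadditive C₂] {ι : Type*}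
    (adj : F ⊣ G) [F.PreservesZeroMorphisms] [G.PreservesZeroMorphisms] (c : ComplexShape ι) :
    F.mapHomologicalComplex c ⊣ G.mapHomologicalComplex c :=
  Adjunction.mkOfUnitCounit
    { unit :=
        { app K :=
            { f i := adj.unit.app (K.X i)
              comm' i j _ := (adj.unit.naturality (K.d i j)).symm }
          naturality _ _ f := by ext i; exact adj.unit.naturality (f.f i) }
      counit :=
        { app K :=
            { f i := adj.counit.app (K.X i)
              comm' i j _ := (adj.counit.naturality (K.d i j)).symm }
          naturality _ _ f := by ext i; exact adj.counit.naturality (f.f i) }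
      left_triangle := by ext K i; simp; exact adj.left_triangle_components (K.X i)
      right_triangle := by ext K i; simp; exact adj.right_triangle_components (K.X i) }

variable [Abelian C₁] [Abelian C₂] [HasDerivedCategory C₁] [HasDerivedCategory C₂]
  [F.Additive] [PreservesFiniteLimits F] [PreservesFiniteColimits F]
  [G.Additive] [PreservesFiniteLimits G] [PreservesFiniteColimits G]

/-- An adjunction between exact functors induces an adjunction on derived categories. -/
noncomputable def Adjunction.mapDerivedCategory (adj : F ⊣ G) :
    F.mapDerivedCategory ⊣ G.mapDerivedCategory :=
  letI : CatCommSq (F.mapHomologicalComplex (ComplexShape.up ℤ)) DerivedCategory.Q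
    DerivedCategory.Q F.mapDerivedCategory := ⟨F.mapDerivedCategoryFactors.symm⟩
  letI : CatCommSq (G.mapHomologicalComplex (ComplexShape.up ℤ)) DerivedCategory.Q
    DerivedCategory.Q G.mapDerivedCategory := ⟨G.mapDerivedCategoryFactors.symm⟩
  (adj.mapHomologicalComplex (ComplexShape.up ℤ)).localization DerivedCategory.Q
    (HomologicalComplex.quasiIso C₁ (ComplexShape.up ℤ)) DerivedCategory.Q
    (HomologicalComplex.quasiIso C₂ (ComplexShape.up ℤ)) _ _

/-- If an exact functor with an exact left adjoint is fully faithful, so is its extension to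
derived categories. -/
noncomputable def Adjunction.fullyFaithfulMapDerivedCategoryRight (adj : F ⊣ G) [G.Full]
    [G.Faithful] : G.mapDerivedCategory.FullyFaithful := by
  have : IsIso adj.mapDerivedCategory.counit := by
    -- On the image of a complex, the derived counit is built from the degreewise counit, an
    -- isomorphism by full faithfulness. This suffices, as every object is isomorphic to such an
    -- image.
    have (Y : _) : IsIso (adj.mapDerivedCategory.counit.app (DerivedCategory.Q.obj Y)) := by
      have : IsIso ((adj.mapHomologicalComplex (ComplexShape.up ℤ)).counit.app Y) := by
        have (i : ℤ) : IsIso (((adj.mapHomologicalComplex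
          (ComplexShape.up ℤ)).counit.app Y).f i) := by
          exact inferInstanceAs (IsIso (adj.counit.app (Y.X i)))
        exact HomologicalComplex.Hom.isIso_of_components _
      rw [Adjunction.mapDerivedCategory, Adjunction.localization_counit_app]
      infer_instance
    have (Y : _) : IsIso (adj.mapDerivedCategory.counit.app Y) := by
      rw [← NatTrans.isIso_app_iff_of_iso _ (DerivedCategory.Q.objObjPreimageIso Y)]
      infer_instance
    exact NatIso.isIso_of_isIso_app _
  exact adj.mapDerivedCategory.fullyFaithfulROfIsIsoCounit

/-- If an exact functor with an exact right adjoint is fully faithful, so is its extension to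
derived categories. -/
noncomputable def Adjunction.fullyFaithfulMapDerivedCategoryLeft (adj : F ⊣ G) [F.Full]
    [F.Faithful] : F.mapDerivedCategory.FullyFaithful := by
  have : IsIso adj.mapDerivedCategory.unit := by
    have (Y : _) : IsIso (adj.mapDerivedCategory.unit.app (DerivedCategory.Q.obj Y)) := by
      have : IsIso ((adj.mapHomologicalComplex (ComplexShape.up ℤ)).unit.app Y) := by
        have (i : ℤ) : IsIso (((adj.mapHomologicalComplex
          (ComplexShape.up ℤ)).unit.app Y).f i) := by
          exact inferInstanceAs (IsIso (adj.unit.app (Y.X i)))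
        exact HomologicalComplex.Hom.isIso_of_components _
      rw [Adjunction.mapDerivedCategory, Adjunction.localization_unit_app]
      infer_instance
    have (Y : _) : IsIso (adj.mapDerivedCategory.unit.app Y) := by
      rw [← NatTrans.isIso_app_iff_of_iso _ (DerivedCategory.Q.objObjPreimageIso Y)]
      infer_instance
    exact NatIso.isIso_of_isIso_app _
  exact adj.mapDerivedCategory.fullyFaithfulLOfIsIsoUnit

end DerivedAdjunction

/-! ### Cohomology of exact functors: boundedness and detection of zero objects -/

section Homology

variable {C₁ C₂ : Type*} [Category* C₁] [Category* C₂] [Abelian C₁] [Abelian C₂]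
  [HasDerivedCategory C₁] [HasDerivedCategory C₂]
  (F : C₁ ⥤ C₂) [F.Additive] [PreservesFiniteLimits F] [PreservesFiniteColimits F]

/-- The cohomology of the image under an exact functor. -/
noncomputable def Functor.mapDerivedCategoryHomologyIso (X : DerivedCategory C₁) (n : ℤ) :
    (DerivedCategory.homologyFunctor C₂ n).obj (F.mapDerivedCategory.obj X) ≅
      F.obj ((DerivedCategory.homologyFunctor C₁ n).obj X) :=
  let K := DerivedCategory.Q.objPreimage X
  let e := DerivedCategory.Q.objObjPreimageIso X
  (DerivedCategory.homologyFunctor C₂ n).mapIso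
      (F.mapDerivedCategory.mapIso e.symm ≪≫ F.mapDerivedCategoryFactors.app K) ≪≫
    (DerivedCategory.homologyFunctorFactors C₂ n).app _ ≪≫
    (K.sc n).mapHomologyIso F ≪≫
    F.mapIso ((DerivedCategory.homologyFunctorFactors C₁ n).symm.app K ≪≫
      (DerivedCategory.homologyFunctor C₁ n).mapIso e)

/-- An acyclic object is both `≥ 1` and `≤ 0` for the canonical t-structure, and there are no
nonzero morphisms from the second half to the first, so its identity vanishes. -/
lemma DerivedCategory.isZero_iff_homology (X : DerivedCategory C₁) :
    IsZero X ↔ ∀ n, IsZero ((DerivedCategory.homologyFunctor C₁ n).obj X) := by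
  refine ⟨fun h n => Functor.map_isZero _ h, fun h => ?_⟩
  have h₁ : X.IsGE 1 := (X.isGE_iff 1).2 fun i _ => h i
  have h₂ : X.IsLE 0 := (X.isLE_iff 0).2 fun i _ => h i
  rw [IsZero.iff_id_eq_zero]
  exact DerivedCategory.TStructure.t.zero (𝟙 X) 0 1 (by lia)

lemma Functor.mapDerivedCategory_bounded (X : DerivedCategory C₁)
    (hX : DerivedCategory.TStructure.t.bounded X) :
    DerivedCategory.TStructure.t.bounded (F.mapDerivedCategory.obj X) := by
  obtain ⟨⟨a, ha⟩, ⟨b, hb⟩⟩ := hX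
  refine ⟨⟨a, ?_⟩, ⟨b, ?_⟩⟩
  · have : X.IsGE a := ha
    refine ((DerivedCategory.isGE_iff _ a).2 fun i hi => ?_)
    exact (F.map_isZero (X.isZero_of_isGE a i hi)).of_iso (F.mapDerivedCategoryHomologyIso X i)
  · have : X.IsLE b := hb
    refine ((DerivedCategory.isLE_iff _ b).2 fun i hi => ?_)
    exact (F.map_isZero (X.isZero_of_isLE b i hi)).of_iso (F.mapDerivedCategoryHomologyIso X i)

/-- Exact functors commute with cohomology, so joint detection of zero objects can be tested on each
cohomology object. -/
lemma DerivedCategory.isZero_of_isZero_map {C₃ : Type*} [Category* C₃] [Abelian C₃]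
    [HasDerivedCategory C₃] (G : C₁ ⥤ C₃) [G.Additive] [PreservesFiniteLimits G]
    [PreservesFiniteColimits G]
    (h : ∀ X, IsZero (F.obj X) → IsZero (G.obj X) → IsZero X) (X : DerivedCategory C₁)
    (hF : IsZero (F.mapDerivedCategory.obj X)) (hG : IsZero (G.mapDerivedCategory.obj X)) :
    IsZero X := by
  rw [DerivedCategory.isZero_iff_homology] at hF hG ⊢
  exact fun n => h _ ((hF n).of_iso (F.mapDerivedCategoryHomologyIso X n).symm)
    ((hG n).of_iso (G.mapDerivedCategoryHomologyIso X n).symm)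

lemma Functor.isZero_mapDerivedCategory_obj_obj {C₃ : Type*} [Category* C₃] [Abelian C₃]
    [HasDerivedCategory C₃] (G : C₂ ⥤ C₃) [G.Additive] [PreservesFiniteLimits G]
    [PreservesFiniteColimits G] (h : ∀ X, IsZero (G.obj (F.obj X))) (X : DerivedCategory C₁) :
    IsZero (G.mapDerivedCategory.obj (F.mapDerivedCategory.obj X)) := by
  rw [DerivedCategory.isZero_iff_homology]
  exact fun n => (h _).of_iso (G.mapDerivedCategoryHomologyIso _ n ≪≫
    G.mapIso (F.mapDerivedCategoryHomologyIso X n))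

end Homology

end CategoryTheory

/-! ### Triangles and universal arrows -/

namespace CategoryTheory

open Limits Pretriangulated

/-- In the long exact sequence of `Hom(-, Y)`, `h₁` gives surjectivity and `h₂` injectivity. -/
lemma Pretriangulated.bijective_precomp_mor₂ {T : Type*} [Category* T] [HasZeroObject T]
    [Preadditive T] [HasShift T ℤ] [∀ n : ℤ, (shiftFunctor T n).Additive] [Pretriangulated T]
    (D : Triangle T) (hD : D ∈ distTriang T) (Y : T) (h₁ : ∀ f : D.obj₁ ⟶ Y, f = 0)
    (h₂ : ∀ f : D.obj₁⟦(1 : ℤ)⟧ ⟶ Y, f = 0) :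
    Function.Bijective (fun f : D.obj₃ ⟶ Y => D.mor₂ ≫ f) := by
  constructor
  · intro f g hfg
    obtain ⟨φ, hφ⟩ := Triangle.yoneda_exact₃ D hD (f - g)
      (by rw [Preadditive.comp_sub]; exact sub_eq_zero.2 hfg)
    rw [h₂ φ, comp_zero] at hφ
    exact sub_eq_zero.1 hφ
  · intro f
    obtain ⟨φ, hφ⟩ := Triangle.yoneda_exact₂ D hD f (h₁ _)
    exact ⟨φ, hφ.symm⟩

lemma Pretriangulated.bijective_postcomp_mor₂ {T : Type*} [Category* T] [HasZeroObject T]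
    [Preadditive T] [HasShift T ℤ] [∀ n : ℤ, (shiftFunctor T n).Additive] [Pretriangulated T]
    (D : Triangle T) (hD : D ∈ distTriang T) (Y : T) (h₁ : ∀ f : Y ⟶ D.obj₁, f = 0)
    (h₂ : ∀ f : Y ⟶ D.obj₁⟦(1 : ℤ)⟧, f = 0) :
    Function.Bijective (fun f : Y ⟶ D.obj₂ => f ≫ D.mor₂) := by
  constructor
  · intro f g hfg
    obtain ⟨φ, hφ⟩ := Triangle.coyoneda_exact₂ D hD (f - g)
      (by rw [Preadditive.sub_comp]; exact sub_eq_zero.2 hfg)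
    rw [h₁ φ, zero_comp] at hφ
    exact sub_eq_zero.1 hφ
  · intro f
    obtain ⟨φ, hφ⟩ := Triangle.coyoneda_exact₃ D hD f (h₂ _)
    exact ⟨φ, hφ.symm⟩

section Triangles

variable {T : Type*} [Category* T] [HasZeroObject T]
  [Preadditive T] [HasShift T ℤ] [∀ n : ℤ, (shiftFunctor T n).Additive] [Pretriangulated T]
  {X Y Z : T} {f : X ⟶ Y} {g : Y ⟶ Z} {h : Z ⟶ X⟦(1 : ℤ)⟧}

lemma Pretriangulated.distinguished_of_iso₃ (hT : Triangle.mk f g h ∈ distTriang T) {Z' : T}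
    (e : Z ≅ Z') {g' : Y ⟶ Z'} {h' : Z' ⟶ X⟦(1 : ℤ)⟧} (hg : g ≫ e.hom = g')
    (hh : e.hom ≫ h' = h) : Triangle.mk f g' h' ∈ distTriang T := by
  refine isomorphic_distinguished _ hT _
    (Triangle.isoMk _ _ (Iso.refl X) (Iso.refl Y) e.symm ?_ ?_ ?_)
  · exact (Category.comp_id f).trans (Category.id_comp f).symm
  · exact ((Iso.comp_inv_eq e).2 hg.symm).trans (Category.id_comp g).symm
  · change h' ≫ (𝟙 X)⟦(1 : ℤ)⟧' = e.inv ≫ h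
    rw [Functor.map_id, Category.comp_id, ← hh, Iso.inv_hom_id_assoc]

lemma Pretriangulated.distinguished_of_iso₁ (hT : Triangle.mk f g h ∈ distTriang T) {X' : T}
    (e : X ≅ X') {f' : X' ⟶ Y} {h' : Z ⟶ X'⟦(1 : ℤ)⟧} (hf : e.hom ≫ f' = f)
    (hh : h ≫ e.hom⟦(1 : ℤ)⟧' = h') : Triangle.mk f' g h' ∈ distTriang T := by
  refine isomorphic_distinguished _ hT _
    (Triangle.isoMk _ _ e.symm (Iso.refl Y) (Iso.refl Z) ?_ ?_ ?_)
  · change f' ≫ 𝟙 Y = e.inv ≫ f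
    rw [Category.comp_id, ← hf, Iso.inv_hom_id_assoc]
  · exact (Category.comp_id g).trans (Category.id_comp g).symm
  · change h' ≫ e.inv⟦(1 : ℤ)⟧' = 𝟙 Z ≫ h
    rw [Category.id_comp, ← hh, Category.assoc, ← Functor.map_comp, Iso.hom_inv_id,
      Functor.map_id, Category.comp_id]

end Triangles

/-- A morphism `u : X ⟶ G.obj Y` which is universal among morphisms to the image of `G`. -/
def Functor.IsUniversalTo {C D : Type*} [Category* C] [Category* D] (G : D ⥤ C) {X : C} {Y : D}
    (u : X ⟶ G.obj Y) : Prop :=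
  ∀ Z : D, Function.Bijective (fun f : Y ⟶ Z => u ≫ G.map f)

section UniversalTo

variable {C D : Type*} [Category* C] [Category* D] {G : D ⥤ C}

lemma Functor.IsUniversalTo.exists_iso {X : C} {Y Y' : D} {u : X ⟶ G.obj Y} {u' : X ⟶ G.obj Y'}
    (hu : G.IsUniversalTo u) (hu' : G.IsUniversalTo u') : ∃ e : Y ≅ Y', u ≫ G.map e.hom = u' := by
  obtain ⟨f, hf⟩ := (hu Y').2 u'
  obtain ⟨g, hg⟩ := (hu' Y).2 u
  dsimp at hf hg
  exact ⟨⟨f, g, (hu Y).1 (by simp [reassoc_of% hf, hg]),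
    (hu' Y').1 (by simp [reassoc_of% hg, hf])⟩, hf⟩

lemma Adjunction.isUniversalTo_unit {F : C ⥤ D} (adj : F ⊣ G) (X : C) :
    G.IsUniversalTo (adj.unit.app X) := fun Z => by
  have h : (fun f : F.obj X ⟶ Z => adj.unit.app X ≫ G.map f) = adj.homEquiv X Z :=
    funext fun f => (adj.homEquiv_unit ..).symm
  exact h ▸ (adj.homEquiv X Z).bijective

lemma Functor.exists_adjunction_of_isUniversalTo
    (h : ∀ X : C, ∃ (Y : D) (u : X ⟶ G.obj Y), G.IsUniversalTo u) :
    ∃ F : C ⥤ D, Nonempty (F ⊣ G) := by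
  choose Y u hu using h
  exact ⟨_, ⟨Adjunction.adjunctionOfEquivLeft (F_obj := Y)
    (e := fun X Z => Equiv.ofBijective _ (hu X Z)) (by intros; simp)⟩⟩

end UniversalTo

/-! ### Mutation between the two orthogonals of a subcategory -/

section Mutation

variable {T T₁ T₂ K : Type*} [Category* T] [Category* T₁] [Category* T₂] [Category* K]
  [HasZeroObject T] [Preadditive T] [HasShift T ℤ] [∀ n : ℤ, (shiftFunctor T n).Additive]
  [Pretriangulated T]
  [HasZeroObject T₁] [Preadditive T₁] [HasShift T₁ ℤ] [∀ n : ℤ, (shiftFunctor T₁ n).Additive]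
  [Pretriangulated T₁]
  [HasZeroObject T₂] [Preadditive T₂] [HasShift T₂ ℤ] [∀ n : ℤ, (shiftFunctor T₂ n).Additive]
  [Pretriangulated T₂]
  [HasZeroObject K] [Preadditive K] [HasShift K ℤ] [∀ n : ℤ, (shiftFunctor K n).Additive]
  [Pretriangulated K]
  {b : T₁ ⥤ T} {p : T ⥤ T₁} {c : T₂ ⥤ T} {p' : T ⥤ T₂} {r : K ⥤ T} {evV evW : T ⥤ K}
  [b.CommShift ℤ] [p.CommShift ℤ] [c.CommShift ℤ] [p'.CommShift ℤ] [r.CommShift ℤ]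
  [evV.CommShift ℤ] [evW.CommShift ℤ]
  [b.IsTriangulated] [p.IsTriangulated] [c.IsTriangulated] [p'.IsTriangulated]
  [r.IsTriangulated] [evV.IsTriangulated] [evW.IsTriangulated]

lemma Adjunction.comp_triangulated_zero_right (adjV : r ⊣ evV) {Y : T}
    (hY : IsZero (evV.obj Y)) (k : K) (f : r.obj k ⟶ Y) : f = 0 :=
  (adjV.homEquiv _ _).injective (hY.eq_of_tgt _ _)

lemma Adjunction.shift_comp_triangulated_zero_right (adjV : r ⊣ evV) {Y : T}
    (hY : IsZero (evV.obj Y)) (k : K) (n : ℤ) (f : (r.obj k)⟦n⟧ ⟶ Y) : f = 0 := by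
  rw [← cancel_epi ((r.commShiftIso n).hom.app k), comp_zero]
  exact adjV.comp_triangulated_zero_right hY _ _

lemma Adjunction.comp_triangulated_zero_left (adjW : evW ⊣ r) {Y : T}
    (hY : IsZero (evW.obj Y)) (k : K) (f : Y ⟶ r.obj k) : f = 0 :=
  (adjW.homEquiv _ _).symm.injective (hY.eq_of_src _ _)

lemma Adjunction.shift_comp_triangulated_zero_left (adjW : evW ⊣ r) {Y : T}
    (hY : IsZero (evW.obj Y)) (k : K) (f : Y ⟶ (r.obj k)⟦(1 : ℤ)⟧) : f = 0 := by
  rw [← cancel_mono ((r.commShiftIso (1 : ℤ)).inv.app k), zero_comp]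
  exact adjW.comp_triangulated_zero_left hY _ _

/-- If `c ⊣ p'` with `c` fully faithful, and `p'` and `evV` jointly detect zero objects, then an
object killed by `evV` lies in the image of `c`. -/
lemma Adjunction.isIso_counit_of_isZero (adjc : c ⊣ p') [c.Full] [c.Faithful]
    (hVc : ∀ Y, IsZero (evV.obj (c.obj Y)))
    (hV : ∀ X, IsZero (evV.obj X) → IsZero (p'.obj X) → IsZero X) (X : T)
    (hX : IsZero (evV.obj X)) : IsIso (adjc.counit.app X) := by
  obtain ⟨Z, g, h, hT⟩ := distinguished_cocone_triangle (adjc.counit.app X)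
  refine (Triangle.isZero₃_iff_isIso₁ _ hT).1 (hV Z ?_ ?_)
  · exact (Triangle.isZero₃_iff_isIso₁ _ (evV.map_distinguished _ hT)).2
      ((hVc _).isIso hX _)
  · refine (Triangle.isZero₃_iff_isIso₁ _ (p'.map_distinguished _ hT)).2 ?_
    exact inferInstanceAs (IsIso (p'.map (adjc.counit.app X)))

/-- The cone of the unit is killed by `evW`, since both ends are, and by `p`, since `b` is fully
faithful; hence it is zero. -/
lemma Adjunction.isIso_unit_of_isZero (adjb : p ⊣ b) [b.Full] [b.Faithful]
    (hWb : ∀ Y, IsZero (evW.obj (b.obj Y)))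
    (hW : ∀ X, IsZero (evW.obj X) → IsZero (p.obj X) → IsZero X) (X : T)
    (hX : IsZero (evW.obj X)) : IsIso (adjb.unit.app X) := by
  obtain ⟨Z, g, h, hT⟩ := distinguished_cocone_triangle (adjb.unit.app X)
  refine (Triangle.isZero₃_iff_isIso₁ _ hT).1 (hW Z ?_ ?_)
  · exact (Triangle.isZero₃_iff_isIso₁ _ (evW.map_distinguished _ hT)).2
      (hX.isIso (hWb _) _)
  · refine (Triangle.isZero₃_iff_isIso₁ _ (p.map_distinguished _ hT)).2 ?_
    exact inferInstanceAs (IsIso (p.map (adjb.unit.app X)))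

variable (adjb : p ⊣ b) (adjc : c ⊣ p') (adjW : evW ⊣ r) (adjV : r ⊣ evV)
  [b.Full] [b.Faithful] [c.Full] [c.Faithful] [r.Full] [r.Faithful]
  (hWb : ∀ X, IsZero (evW.obj (b.obj X))) (hVc : ∀ Y, IsZero (evV.obj (c.obj Y)))
  (hV : ∀ X, IsZero (evV.obj X) → IsZero (p'.obj X) → IsZero X)
  (hW : ∀ X, IsZero (evW.obj X) → IsZero (p.obj X) → IsZero X)

-- Take the cone of the counit `r (evV X) ⟶ X`. As `r` is fully faithful, `evV` inverts this counit
-- and so kills the cone, which therefore lies in the image of `c`.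
include adjc adjV hVc hV in
lemma exists_distinguished_to_right (X : T) :
    ∃ (Y : T₂) (f : r.obj (evV.obj X) ⟶ X) (g : X ⟶ c.obj Y) (h : c.obj Y ⟶ _),
      Triangle.mk f g h ∈ distTriang T := by
  obtain ⟨Z, g, h, hT⟩ := distinguished_cocone_triangle (adjV.counit.app X)
  have hZ : IsZero (evV.obj Z) := by
    refine (Triangle.isZero₃_iff_isIso₁ _ (evV.map_distinguished _ hT)).2 ?_
    exact inferInstanceAs (IsIso (evV.map (adjV.counit.app X)))
  have := adjc.isIso_counit_of_isZero hVc hV Z hZ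
  let e := (asIso (adjc.counit.app Z)).symm
  refine ⟨p'.obj Z, adjV.counit.app X, g ≫ e.hom, e.inv ≫ h,
    distinguished_of_iso₃ hT e rfl (by simp)⟩

include adjb adjW hWb hW in
lemma exists_distinguished_from_left (X : T) :
    ∃ (Y : T₁) (f : b.obj Y ⟶ X) (g : X ⟶ r.obj (evW.obj X)) (h : _ ⟶ _),
      Triangle.mk f g h ∈ distTriang T := by
  obtain ⟨Z, g, h, hT⟩ := distinguished_cocone_triangle₁ (adjW.unit.app X)
  have hZ : IsZero (evW.obj Z) := by
    refine (Triangle.isZero₁_iff_isIso₂ _ (evW.map_distinguished _ hT)).2 ?_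
    exact inferInstanceAs (IsIso (evW.map (adjW.unit.app X)))
  have := adjb.isIso_unit_of_isZero hWb hW Z hZ
  let e := asIso (adjb.unit.app Z)
  refine ⟨p.obj Z, e.inv ≫ g, adjW.unit.app X, h ≫ e.hom⟦(1 : ℤ)⟧',
    distinguished_of_iso₁ hT e (by simp) rfl⟩

-- Neither `r k` nor its shift maps nontrivially to the image of `c`. Thus `Y` is the value at `X`
-- of a left adjoint of `c`, whichever triangle produced it.
include adjV hVc in
lemma isUniversalTo_of_distinguished {X : T} {Y : T₂} {k : K} {f : r.obj k ⟶ X}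
    {g : X ⟶ c.obj Y} {h : c.obj Y ⟶ _} (hT : Triangle.mk f g h ∈ distTriang T) :
    c.IsUniversalTo g := fun Z =>
  (bijective_precomp_mor₂ _ hT (c.obj Z) (adjV.comp_triangulated_zero_right (hVc Z) k)
    (adjV.shift_comp_triangulated_zero_right (hVc Z) k 1)).comp
      ((Functor.FullyFaithful.ofFullyFaithful c).map_bijective _ _)

include adjb adjc adjW adjV hWb hVc hV hW in
/-- Mutation of semiorthogonal decompositions: if `b` and `c` embed `T₁` and `T₂` as the left and
the right orthogonal of the same subcategory, the image of `r`, then `T₁` and `T₂` are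
equivalent. -/
theorem exists_triangulated_equivalence_of_mutation :
    ∃ (Φ : T₁ ⥤ T₂) (_ : Φ.CommShift ℤ), Φ.IsEquivalence ∧ Φ.IsTriangulated ∧
      (∀ X, ∃ (f : r.obj (evV.obj (b.obj X)) ⟶ b.obj X) (g : b.obj X ⟶ c.obj (Φ.obj X))
        (h : c.obj (Φ.obj X) ⟶ _), Triangle.mk f g h ∈ distTriang T) ∧
      (∀ Y, ∃ (X : T₁) (f : b.obj X ⟶ c.obj Y) (g : c.obj Y ⟶ r.obj (evW.obj (c.obj Y)))
        (h : _ ⟶ _), Triangle.mk f g h ∈ distTriang T ∧ Nonempty (Φ.obj X ≅ Y)) := by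
  -- The cone is not functorial by itself; its universal property makes it the left adjoint `F` of
  -- `c`, which inherits the shift and triangulated structures from `c`.
  obtain ⟨F, ⟨adj⟩⟩ := c.exists_adjunction_of_isUniversalTo fun X => by
    obtain ⟨Y, f, g, h, hT⟩ := exists_distinguished_to_right adjc adjV hVc hV X
    exact ⟨Y, g, isUniversalTo_of_distinguished adjV hVc hT⟩
  let : F.CommShift ℤ := adj.leftAdjointCommShift ℤ
  have : adj.CommShift ℤ := adj.commShift_of_rightAdjoint ℤ
  have : F.IsTriangulated := adj.isTriangulated_leftAdjoint
  have tri (X : T) : ∃ (f : r.obj (evV.obj X) ⟶ X) (h : c.obj (F.obj X) ⟶ _),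
      Triangle.mk f (adj.unit.app X) h ∈ distTriang T := by
    obtain ⟨Y, f, g, h, hT⟩ := exists_distinguished_to_right adjc adjV hVc hV X
    obtain ⟨e, he⟩ := (adj.isUniversalTo_unit X).exists_iso
      (isUniversalTo_of_distinguished adjV hVc hT)
    exact ⟨f, c.map e.hom ≫ h, distinguished_of_iso₃ hT (c.mapIso e.symm)
      (by simp [← he, ← Functor.map_comp]) (by simp [← Functor.map_comp_assoc])⟩
  -- `Hom(bX, bX') ≅ Hom(bX, cFbX')`, because `bX` has no morphisms to the image of `r` or its
  -- shift; the right side is `Hom(FbX, FbX')` by adjunction.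
  have ff (X X' : T₁) : Function.Bijective (fun f : X ⟶ X' => F.map (b.map f)) := by
    obtain ⟨f, h, hT⟩ := tri (b.obj X')
    have h₁ := bijective_postcomp_mor₂ _ hT (b.obj X)
      (adjW.comp_triangulated_zero_left (hWb X) _)
      (adjW.shift_comp_triangulated_zero_left (hWb X) _)
    have h₂ := (((adj.homEquiv (b.obj X) (F.obj (b.obj X'))).symm.bijective.comp h₁).comp
      ((Functor.FullyFaithful.ofFullyFaithful b).map_bijective X X'))
    convert h₂ using 2 with f
    exact ((adj.homEquiv _ _).symm_apply_apply _).symm.trans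
      (congrArg _ ((adj.homEquiv_unit ..).trans (adj.unit.naturality (b.map f)).symm))
  have surj (Y : T₂) : ∃ (X : T₁) (f : b.obj X ⟶ c.obj Y)
      (g : c.obj Y ⟶ r.obj (evW.obj (c.obj Y))) (h : _ ⟶ _),
      Triangle.mk f g h ∈ distTriang T ∧ Nonempty (F.obj (b.obj X) ≅ Y) := by
    obtain ⟨X, f, g, h, hT⟩ := exists_distinguished_from_left adjb adjW hWb hW (c.obj Y)
    refine ⟨X, f, g, h, hT, ?_⟩
    -- Rotated backwards, the triangle starts at a shift by `-1` of an object `r k`, so `bX ⟶ cY` is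
    -- itself universal and `FbX ≅ Y`.
    have hf : c.IsUniversalTo f := fun Z => by
      have h₀ := adjV.shift_comp_triangulated_zero_right (hVc Z) (evW.obj (c.obj Y))
      refine (bijective_precomp_mor₂ _ (inv_rot_of_distTriang _ hT) (c.obj Z) (h₀ (-1))
        fun φ => ?_).comp ((Functor.FullyFaithful.ofFullyFaithful c).map_bijective _ _)
      let e := (shiftFunctorCompIsoId T (-1 : ℤ) 1 (by lia)).app (r.obj (evW.obj (c.obj Y)))
      exact (cancel_epi e.inv).1
        ((adjV.comp_triangulated_zero_right (hVc Z) _ (e.inv ≫ φ)).trans comp_zero.symm)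
    obtain ⟨e, -⟩ := (adj.isUniversalTo_unit (b.obj X)).exists_iso hf
    exact ⟨e⟩
  refine ⟨b ⋙ F, inferInstance, ?_, inferInstance, fun X => ?_, surj⟩
  · have : (b ⋙ F).Faithful := ⟨fun {X X'} _ _ h => (ff X X').1 h⟩
    have : (b ⋙ F).Full := ⟨fun {X X'} => (ff X X').2⟩
    have : (b ⋙ F).EssSurj := ⟨fun Y => by
      obtain ⟨X, _, _, _, _, e⟩ := surj Y
      exact ⟨X, e⟩⟩
    exact { }
  · obtain ⟨f, h, hT⟩ := tri (b.obj X)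
    exact ⟨f, _, h, hT⟩

end Mutation

end CategoryTheory

/-! ### Restriction to bounded derived categories -/

namespace CategoryTheory

open Limits Pretriangulated DerivedCategory.TStructure

/-- Abelian form of the mutation theorem: exact functors with exact adjoints whose images on derived
categories form semiorthogonal decompositions as in `exists_triangulated_equivalence_of_mutation`
yield an equivalence of bounded derived categories. -/
theorem exists_bounded_derived_equivalence {A C E K : Type*} [Category* A] [Category* C]
    [Category* E] [Category* K] [Abelian A] [Abelian C] [Abelian E] [Abelian K]
    [HasDerivedCategory A] [HasDerivedCategory C] [HasDerivedCategory E] [HasDerivedCategory K]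
    {b : A ⥤ E} {p : E ⥤ A} {c : C ⥤ E} {p' : E ⥤ C} {r : K ⥤ E} {evV evW : E ⥤ K}
    [b.Additive] [PreservesFiniteLimits b] [PreservesFiniteColimits b]
    [p.Additive] [PreservesFiniteLimits p] [PreservesFiniteColimits p]
    [c.Additive] [PreservesFiniteLimits c] [PreservesFiniteColimits c]
    [p'.Additive] [PreservesFiniteLimits p'] [PreservesFiniteColimits p']
    [r.Additive] [PreservesFiniteLimits r] [PreservesFiniteColimits r]
    [evV.Additive] [PreservesFiniteLimits evV] [PreservesFiniteColimits evV]
    [evW.Additive] [PreservesFiniteLimits evW] [PreservesFiniteColimits evW]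
    [b.Full] [b.Faithful] [c.Full] [c.Faithful] [r.Full] [r.Faithful]
    (adjb : p ⊣ b) (adjc : c ⊣ p') (adjW : evW ⊣ r) (adjV : r ⊣ evV)
    (hWb : ∀ X, IsZero (evW.obj (b.obj X))) (hVc : ∀ Y, IsZero (evV.obj (c.obj Y)))
    (hV : ∀ X, IsZero (evV.obj X) → IsZero (p'.obj X) → IsZero X)
    (hW : ∀ X, IsZero (evW.obj X) → IsZero (p.obj X) → IsZero X) :
    ∃ (F : DerivedCategory.Bounded A ⥤ DerivedCategory.Bounded C) (_ : F.CommShift ℤ),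
      F.IsEquivalence ∧ F.IsTriangulated := by
  have hb := adjb.fullyFaithfulMapDerivedCategoryRight
  have hc := adjc.fullyFaithfulMapDerivedCategoryLeft
  have hr := adjV.fullyFaithfulMapDerivedCategoryLeft
  have := hb.full; have := hb.faithful; have := hc.full; have := hc.faithful
  have := hr.full; have := hr.faithful
  obtain ⟨Φ, _, _, _, h₁, h₂⟩ := exists_triangulated_equivalence_of_mutation
    adjb.mapDerivedCategory adjc.mapDerivedCategory adjW.mapDerivedCategory
    adjV.mapDerivedCategory
    (b.isZero_mapDerivedCategory_obj_obj evW hWb) (c.isZero_mapDerivedCategory_obj_obj evV hVc)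
    (DerivedCategory.isZero_of_isZero_map evV p' hV)
    (DerivedCategory.isZero_of_isZero_map evW p hW)
  -- Two vertices of the triangle are bounded, hence so is `c (Φ X)`, and `Φ X ≅ p' (c (Φ X))`.
  -- Essential surjectivity below uses the other triangle and `X ≅ p (b X)` in the same way.
  have hΦ (X : DerivedCategory.Bounded A) : t.bounded ((t.bounded.ι ⋙ Φ).obj X) := by
    obtain ⟨f, g, h, hT⟩ := h₁ X.obj
    have h₂ := b.mapDerivedCategory_bounded _ X.property
    have h₃ := t.bounded.ext_of_isTriangulatedClosed₃ _ hT
      (r.mapDerivedCategory_bounded _ (evV.mapDerivedCategory_bounded _ h₂)) h₂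
    exact t.bounded.prop_of_iso (asIso (adjc.mapDerivedCategory.unit.app _)).symm
      (p'.mapDerivedCategory_bounded _ h₃)
  refine ⟨t.bounded.lift (t.bounded.ι ⋙ Φ) hΦ, inferInstance, ?_, inferInstance⟩
  have : (t.bounded.lift (t.bounded.ι ⋙ Φ) hΦ).EssSurj := ⟨fun Y => by
    obtain ⟨X, f, g, h, hT, ⟨e⟩⟩ := h₂ Y.obj
    have h₂ := c.mapDerivedCategory_bounded _ Y.property
    have h₁ := t.bounded.ext_of_isTriangulatedClosed₁ _ hT h₂
      (r.mapDerivedCategory_bounded _ (evW.mapDerivedCategory_bounded _ h₂))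
    have hX : t.bounded X :=
      t.bounded.prop_of_iso (asIso (adjb.mapDerivedCategory.counit.app X))
        (p.mapDerivedCategory_bounded _ h₁)
    exact ⟨⟨X, hX⟩, ⟨t.bounded.isoMk e⟩⟩⟩
  exact { }

end CategoryTheory

/-! ### Idempotent truncation and restriction of scalars -/

section Truncation

open Limits

variable {A S : Type*} [Ring A] [Ring S] (i : A →ₙ+* S)

/-- For a non-unital ring homomorphism `i : A → S` with idempotent `e = i 1`, the additive group
`e N` of an `S`-module `N`. -/
def truncation (N : Type*) [AddCommGroup N] [Module S N] : AddSubgroup N where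
  carrier := {n | i 1 • n = n}
  zero_mem' := smul_zero _
  add_mem' {a b} ha hb := by
    change _ • (_ + _) = _
    rw [smul_add, ha, hb]
  neg_mem' {a} ha := by
    change _ • (-_) = _
    rw [smul_neg, ha]

namespace truncation

section

variable {i} {N : Type*} [AddCommGroup N] [Module S N]

lemma one_smul_coe (n : truncation i N) : i 1 • (n : N) = n := n.2

lemma smul_mem (a : A) (n : N) : i a • n ∈ truncation i N := by
  change i 1 • _ = _
  rw [← mul_smul, ← map_mul, one_mul]

instance : Module A (truncation i N) where
  smul a n := ⟨i a • (n : N), smul_mem a _⟩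
  one_smul n := Subtype.ext n.2
  mul_smul a b n := Subtype.ext (by
    change i (a * b) • (n : N) = i a • i b • (n : N)
    rw [map_mul, mul_smul])
  smul_zero a := Subtype.ext (smul_zero (i a))
  smul_add a n n' := Subtype.ext (smul_add (i a) (n : N) n')
  add_smul a b n := Subtype.ext (by
    change i (a + b) • (n : N) = i a • (n : N) + i b • (n : N)
    rw [map_add, add_smul])
  zero_smul n := Subtype.ext (by
    change i 0 • (n : N) = 0
    rw [map_zero, zero_smul])

lemma coe_smul (a : A) (n : truncation i N) : ((a • n : truncation i N) : N) = i a • (n : N) :=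
  rfl

end

end truncation

namespace ModuleCat

/-- The truncation functor `N ↦ e N`, where `e = i 1`. -/
@[simps]
def truncationFunctor : ModuleCat.{u} S ⥤ ModuleCat.{u} A where
  obj N := ModuleCat.of A (truncation i N)
  map {N N'} f := ModuleCat.ofHom
    { toFun := fun n => ⟨f.hom n, by
        change i 1 • f.hom (n : N) = _
        rw [← f.hom.map_smul, truncation.one_smul_coe]⟩
      map_add' := fun n n' => Subtype.ext (f.hom.map_add (n : N) n')
      map_smul' := fun a n => Subtype.ext (f.hom.map_smul (i a) (n : N)) }

instance : (truncationFunctor.{u} i).Additive where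

lemma truncationFunctor_map_exact (T : ShortComplex (ModuleCat.{u} S)) (hT : T.Exact) :
    (T.map (truncationFunctor i)).Exact := by
  rw [ShortComplex.moduleCat_exact_iff] at hT ⊢
  intro n hn
  obtain ⟨m, hm⟩ := hT n.1 (congrArg Subtype.val hn)
  -- Multiplying a preimage by the idempotent moves it into the truncation, and it still maps to `n`
  -- because `i 1 • n = n`.
  refine ⟨⟨i 1 • m, truncation.smul_mem 1 m⟩, Subtype.ext ?_⟩
  change T.f.hom (i 1 • m) = n.1
  rw [map_smul]
  exact (congrArg (i 1 • ·) hm).trans n.2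

instance : PreservesFiniteLimits (truncationFunctor.{u} i) :=
  ((truncationFunctor.{u} i).exact_tfae.out 1 3 rfl rfl).1 (truncationFunctor_map_exact i) |>.1

instance : PreservesFiniteColimits (truncationFunctor.{u} i) :=
  ((truncationFunctor.{u} i).exact_tfae.out 1 3 rfl rfl).1 (truncationFunctor_map_exact i) |>.2

variable {i} {π : S →+* A}

/-- If `π (i a) = a` and `e s = i (π s)`, then `N ↦ e N` is left adjoint to restriction
of scalars along `π`. -/
noncomputable def truncationAdjRestrictScalars (hπ : ∀ a, π (i a) = a) (h : ∀ s, i 1 * s = i (π s)) :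
    truncationFunctor.{u} i ⊣ restrictScalars.{u} π :=
  Adjunction.mkOfHomEquiv
    { homEquiv N Y :=
        { toFun g := ModuleCat.ofHom (Y := (restrictScalars π).obj Y)
            { toFun n := g.hom ⟨i 1 • n, truncation.smul_mem 1 n⟩
              map_add' n n' := (congrArg g.hom (Subtype.ext (smul_add (i 1) n n'))).trans
                (g.hom.map_add _ _)
              map_smul' s n := by
                refine (congrArg g.hom (Subtype.ext ?_)).trans (g.hom.map_smul (π s) _)
                change i 1 • s • n = i (π s) • i 1 • n
                rw [← mul_smul, ← mul_smul, h, ← map_mul, mul_one] }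
          invFun g := ModuleCat.ofHom (X := truncation i N)
            { toFun n := g.hom n.1
              map_add' n n' := g.hom.map_add n.1 n'.1
              map_smul' a n := (g.hom.map_smul (i a) n.1).trans (by
                change π (i a) • (show Y from g.hom n.1) = _
                rw [hπ]; rfl) }
          left_inv g := by
            ext n
            exact congrArg g.hom (Subtype.ext n.2)
          right_inv g := by
            ext n
            refine (g.hom.map_smul (i 1) n).trans ?_
            change π (i 1) • (show Y from g.hom n) = _
            rw [hπ, one_smul]; rfl }
      homEquiv_naturality_left_symm _ _ := rfl
      homEquiv_naturality_right _ _ := rfl }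

/-- If `π (i a) = a` and `s e = i (π s)`, then `N ↦ e N` is right adjoint to restriction
of scalars along `π`. -/
noncomputable def restrictScalarsAdjTruncation (hπ : ∀ a, π (i a) = a) (h : ∀ s, s * i 1 = i (π s)) :
    restrictScalars.{u} π ⊣ truncationFunctor.{u} i :=
  Adjunction.mkOfHomEquiv
    { homEquiv Y N :=
        { toFun g := ModuleCat.ofHom (Y := truncation i N)
            { toFun y := ⟨g.hom y, by
                refine (g.hom.map_smul (i 1) y).symm.trans (congrArg g.hom ?_)
                change π (i 1) • (show Y from y) = y
                rw [hπ, one_smul]⟩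
              map_add' y y' := Subtype.ext (g.hom.map_add y y')
              map_smul' a y := Subtype.ext (by
                refine Eq.trans (congrArg g.hom ?_) (g.hom.map_smul (i a) y)
                change a • y = π (i a) • y
                rw [hπ]) }
          invFun g := ModuleCat.ofHom (X := (restrictScalars π).obj Y)
            { toFun y := (g.hom y).1
              map_add' y y' := congrArg Subtype.val (g.hom.map_add y y')
              map_smul' s y := by
                refine (congrArg Subtype.val (g.hom.map_smul (π s) y)).trans ?_
                refine Eq.trans ?_ (congrArg (s • ·) (g.hom y).2)
                change i (π s) • (g.hom y).1 = s • i 1 • (g.hom y).1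
                rw [← h, mul_smul] }
          left_inv g := rfl
          right_inv g := rfl }
      homEquiv_naturality_left_symm _ _ := rfl
      homEquiv_naturality_right _ _ := rfl }

lemma restrictScalars_map_exact_of_ring (T : ShortComplex (ModuleCat.{u} A)) (hT : T.Exact) :
    (T.map (restrictScalars.{u} π)).Exact := by
  rw [ShortComplex.ShortExact.moduleCat_exact_iff_function_exact] at hT ⊢
  exact hT

lemma preservesFiniteLimits_restrictScalars : PreservesFiniteLimits (restrictScalars.{u} π) :=
  ((restrictScalars.{u} π).exact_tfae.out 1 3 rfl rfl).1 restrictScalars_map_exact_of_ring |>.1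

lemma preservesFiniteColimits_restrictScalars : PreservesFiniteColimits (restrictScalars.{u} π) :=
  ((restrictScalars.{u} π).exact_tfae.out 1 3 rfl rfl).1 restrictScalars_map_exact_of_ring |>.2

lemma restrictScalars_full_of_surjective (hπ : Function.Surjective π) :
    (restrictScalars.{u} π).Full where
  map_surjective {Y Y'} f := by
    refine ⟨ModuleCat.ofHom
      { toFun := f.hom, map_add' := f.hom.map_add, map_smul' := fun a y => ?_ }, rfl⟩
    obtain ⟨s, rfl⟩ := hπ a
    exact f.hom.map_smul s y

lemma isZero_truncation_restrictScalars {A' : Type*} [Ring A'] {j : A' →ₙ+* S}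
    (h : π (j 1) = 0) (Y : ModuleCat.{u} A) :
    IsZero ((truncationFunctor j).obj ((restrictScalars π).obj Y)) := by
  have : Subsingleton (truncation j ((restrictScalars π).obj Y)) := by
    refine ⟨fun a b => ?_⟩
    have h₀ (n : truncation j ((restrictScalars π).obj Y)) : n = 0 := by
      refine Subtype.ext (n.2.symm.trans ?_)
      change π (j 1) • (show Y from n.1) = 0
      rw [h, zero_smul]
    rw [h₀ a, h₀ b]
  exact isZero_of_iff_subsingleton.2 this

lemma isZero_of_isZero_truncation {A' : Type*} [Ring A'] {j : A' →ₙ+* S}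
    (h : i 1 + j 1 = 1) (N : ModuleCat.{u} S) (hi : IsZero ((truncationFunctor i).obj N))
    (hj : IsZero ((truncationFunctor j).obj N)) : IsZero N := by
  have hi := ModuleCat.subsingleton_of_isZero hi
  have hj := ModuleCat.subsingleton_of_isZero hj
  have h₀ (n : N) : n = 0 := by
    have h₁ : i 1 • n = 0 := congrArg Subtype.val
      (hi.elim ⟨i 1 • n, truncation.smul_mem 1 n⟩ (0 : truncation i N))
    have h₂ : j 1 • n = 0 := congrArg Subtype.val
      (hj.elim ⟨j 1 • n, truncation.smul_mem 1 n⟩ (0 : truncation j N))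
    rw [← one_smul S n, ← h, add_smul, h₁, h₂, add_zero]
  have : Subsingleton N := ⟨fun a b => by rw [h₀ a, h₀ b]⟩
  exact isZero_of_subsingleton _

end ModuleCat

end Truncation

/-! ### The glued algebra, its corners, and the duality of its first column and last row -/

section Glued

variable {k : Type u} [Field k]

/-- The algebra of matrices `[[k, 0, 0], [M(q), Λ, 0], [k, D(M(q)), k]]`, obtained from `Λ` by
adjoining both the extension vertex of `B` and the coextension vertex of `C`. -/
@[ext]
structure GluedAlg (q : k) : Type u where
  a : k
  m : SpecialModule q q
  l : LambdaAlg q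
  t : k
  f : DualSpecialModule q q
  c : k

namespace GluedAlg

variable {q : k}

/-- The evaluation pairing of `D(M(q))` and `M(q)`. -/
def pairing : DualSpecialModule q q →ₗ[k] SpecialModule q q →ₗ[k] k := LinearMap.id

@[simp] lemma pairing_op_smul (l : LambdaAlg q) (f : DualSpecialModule q q)
    (m : SpecialModule q q) : pairing (MulOpposite.op l • f) m = pairing f (l • m) := rfl

instance : Zero (GluedAlg q) := ⟨⟨0, 0, 0, 0, 0, 0⟩⟩
instance : One (GluedAlg q) := ⟨⟨1, 0, 1, 0, 0, 1⟩⟩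
instance : Add (GluedAlg q) :=
  ⟨fun s s' => ⟨s.a + s'.a, s.m + s'.m, s.l + s'.l, s.t + s'.t, s.f + s'.f, s.c + s'.c⟩⟩
instance : Neg (GluedAlg q) := ⟨fun s => ⟨-s.a, -s.m, -s.l, -s.t, -s.f, -s.c⟩⟩
noncomputable instance : Mul (GluedAlg q) :=
  ⟨fun s s' => ⟨s.a * s'.a, s'.a • s.m + s.l • s'.m, s.l * s'.l,
    s.t * s'.a + pairing s.f s'.m + s.c * s'.t, MulOpposite.op s'.l • s.f + s.c • s'.f,
    s.c * s'.c⟩⟩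

section

variable (s s' : GluedAlg q)

@[simp] lemma zero_a : (0 : GluedAlg q).a = 0 := rfl
@[simp] lemma zero_m : (0 : GluedAlg q).m = 0 := rfl
@[simp] lemma zero_l : (0 : GluedAlg q).l = 0 := rfl
@[simp] lemma zero_t : (0 : GluedAlg q).t = 0 := rfl
@[simp] lemma zero_f : (0 : GluedAlg q).f = 0 := rfl
@[simp] lemma zero_c : (0 : GluedAlg q).c = 0 := rfl
@[simp] lemma one_a : (1 : GluedAlg q).a = 1 := rfl
@[simp] lemma one_m : (1 : GluedAlg q).m = 0 := rfl
@[simp] lemma one_l : (1 : GluedAlg q).l = 1 := rfl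
@[simp] lemma one_t : (1 : GluedAlg q).t = 0 := rfl
@[simp] lemma one_f : (1 : GluedAlg q).f = 0 := rfl
@[simp] lemma one_c : (1 : GluedAlg q).c = 1 := rfl
@[simp] lemma add_a : (s + s').a = s.a + s'.a := rfl
@[simp] lemma add_m : (s + s').m = s.m + s'.m := rfl
@[simp] lemma add_l : (s + s').l = s.l + s'.l := rfl
@[simp] lemma add_t : (s + s').t = s.t + s'.t := rfl
@[simp] lemma add_f : (s + s').f = s.f + s'.f := rfl
@[simp] lemma add_c : (s + s').c = s.c + s'.c := rfl
@[simp] lemma neg_a : (-s).a = -s.a := rfl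
@[simp] lemma neg_m : (-s).m = -s.m := rfl
@[simp] lemma neg_l : (-s).l = -s.l := rfl
@[simp] lemma neg_t : (-s).t = -s.t := rfl
@[simp] lemma neg_f : (-s).f = -s.f := rfl
@[simp] lemma neg_c : (-s).c = -s.c := rfl
@[simp] lemma mul_a : (s * s').a = s.a * s'.a := rfl
@[simp] lemma mul_m : (s * s').m = s'.a • s.m + s.l • s'.m := rfl
@[simp] lemma mul_l : (s * s').l = s.l * s'.l := rfl
@[simp] lemma mul_t : (s * s').t = s.t * s'.a + pairing s.f s'.m + s.c * s'.t := rfl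
@[simp] lemma mul_f : (s * s').f = MulOpposite.op s'.l • s.f + s.c • s'.f := rfl
@[simp] lemma mul_c : (s * s').c = s.c * s'.c := rfl

end

noncomputable instance : Ring (GluedAlg q) where
  add_assoc _ _ _ := by ext1 <;> simp [add_assoc]
  zero_add _ := by ext1 <;> simp
  add_zero _ := by ext1 <;> simp
  add_comm _ _ := by ext1 <;> simp [add_comm]
  neg_add_cancel _ := by ext1 <;> simp
  mul_assoc s s' s'' := by
    ext1
    · simp [mul_assoc]
    · simp only [mul_a, mul_m, mul_l, smul_add, mul_smul, add_assoc, smul_comm s.l s''.a,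
        mul_comm s'.a s''.a]
    · simp [mul_assoc]
    · simp only [mul_t, mul_a, mul_m, mul_f, mul_c, map_add, LinearMap.add_apply, map_smul,
        LinearMap.smul_apply, pairing_op_smul, smul_eq_mul]
      ring
    · simp only [mul_f, mul_l, mul_c, smul_add, MulOpposite.op_mul, mul_smul, add_assoc,
        smul_comm s.c (MulOpposite.op s''.l)]
    · simp [mul_assoc]
  one_mul _ := by ext1 <;> simp
  mul_one _ := by ext1 <;> simp
  left_distrib s s' s'' := by
    ext1
    · simp [mul_add]
    · simp only [mul_m, add_m, add_a, add_smul, smul_add]; abel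
    · simp [mul_add]
    · simp only [mul_t, add_t, add_a, add_m, map_add]; ring
    · simp only [mul_f, add_f, add_l, MulOpposite.op_add, add_smul, smul_add]; abel
    · simp [mul_add]
  right_distrib s s' s'' := by
    ext1
    · simp [add_mul]
    · simp only [mul_m, add_m, add_l, add_smul, smul_add]; abel
    · simp [add_mul]
    · simp only [mul_t, add_t, add_f, add_c, map_add, LinearMap.add_apply]; ring
    · simp only [mul_f, add_f, add_c, add_smul, smul_add]; abel
    · simp [add_mul]
  zero_mul _ := by ext1 <;> simp
  mul_zero _ := by ext1 <;> simp
  nsmul := nsmulRec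
  zsmul := zsmulRec

variable (q)

/-- The corner `B` of the glued algebra. -/
noncomputable def inclB : AlgB q →ₙ+* GluedAlg q where
  toFun b := ⟨b.a₁₁, b.a₂₁, b.a₂₂, 0, 0, 0⟩
  map_zero' := rfl
  map_add' _ _ := by ext1 <;> simp
  map_mul' _ _ := by ext1 <;> simp

/-- The quotient `B` of the glued algebra. -/
noncomputable def projB : GluedAlg q →+* AlgB q where
  toFun s := ⟨s.a, s.m, s.l⟩
  map_zero' := rfl
  map_one' := rfl
  map_add' _ _ := rfl
  map_mul' _ _ := by ext1 <;> simp

/-- The corner `C` of the glued algebra. -/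
noncomputable def inclC : AlgC q →ₙ+* GluedAlg q where
  toFun b := ⟨0, 0, b.a₁₁, 0, b.a₂₁, b.a₂₂⟩
  map_zero' := rfl
  map_add' _ _ := by ext1 <;> simp
  map_mul' _ _ := by ext1 <;> simp

/-- The quotient `C` of the glued algebra. -/
noncomputable def projC : GluedAlg q →+* AlgC q where
  toFun s := ⟨s.l, s.f, s.c⟩
  map_zero' := rfl
  map_one' := rfl
  map_add' _ _ := rfl
  map_mul' _ _ := rfl

/-- The corner at the extension vertex. -/
noncomputable def inclV : k →ₙ+* GluedAlg q where
  toFun a := ⟨a, 0, 0, 0, 0, 0⟩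
  map_zero' := rfl
  map_add' _ _ := by ext1 <;> simp
  map_mul' _ _ := by ext1 <;> simp

/-- The corner at the coextension vertex. -/
noncomputable def inclW : k →ₙ+* GluedAlg q where
  toFun c := ⟨0, 0, 0, 0, 0, c⟩
  map_zero' := rfl
  map_add' _ _ := by ext1 <;> simp
  map_mul' _ _ := by ext1 <;> simp

variable {q} in
@[simp] lemma inclB_apply (b : AlgB q) : inclB q b = ⟨b.a₁₁, b.a₂₁, b.a₂₂, 0, 0, 0⟩ := rfl
variable {q} in
@[simp] lemma projB_apply (s : GluedAlg q) : projB q s = ⟨s.a, s.m, s.l⟩ := rfl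
variable {q} in
@[simp] lemma inclC_apply (b : AlgC q) : inclC q b = ⟨0, 0, b.a₁₁, 0, b.a₂₁, b.a₂₂⟩ := rfl
variable {q} in
@[simp] lemma projC_apply (s : GluedAlg q) : projC q s = ⟨s.l, s.f, s.c⟩ := rfl
@[simp] lemma inclV_apply (a : k) : inclV q a = ⟨a, 0, 0, 0, 0, 0⟩ := rfl
@[simp] lemma inclW_apply (c : k) : inclW q c = ⟨0, 0, 0, 0, 0, c⟩ := rfl

/-- By triangularity `e_B E = e_B E e_B` for `e_B = inclB q 1`, while for `C` it is `E e_C` that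
equals `e_C E e_C`. This asymmetry is why truncation is left adjoint to restriction for `B` and
right adjoint for `C`. -/
lemma inclB_one_mul (s : GluedAlg q) : inclB q 1 * s = inclB q (projB q s) := by
  ext1 <;> simp

lemma mul_inclC_one (s : GluedAlg q) : s * inclC q 1 = inclC q (projC q s) := by
  ext1 <;> simp

lemma inclV_one_add_inclC_one : inclV q 1 + inclC q 1 = 1 := by
  ext1 <;> simp

lemma inclW_one_add_inclB_one : inclW q 1 + inclB q 1 = 1 := by
  ext1 <;> simp

/-- The first column of the glued algebra. -/
abbrev Column : Type u := k × SpecialModule q q × k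

variable {q}

/-- The action of the glued algebra on its first column. -/
noncomputable def columnEnd (s : GluedAlg q) : Module.End k (Column q) where
  toFun x := (s.a * x.1, x.1 • s.m + s.l • x.2.1, s.t * x.1 + pairing s.f x.2.1 + s.c * x.2.2)
  map_add' x y := by
    refine Prod.ext ?_ (Prod.ext ?_ ?_)
    · simp [mul_add]
    · simp only [Prod.fst_add, Prod.snd_add, add_smul, smul_add]; abel
    · simp only [Prod.fst_add, Prod.snd_add, mul_add, map_add]; ring
  map_smul' r x := by
    refine Prod.ext ?_ (Prod.ext ?_ ?_)
    · simp [mul_left_comm]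
    · simp [smul_smul, smul_comm s.l r]
    · simp only [Prod.smul_fst, Prod.smul_snd, smul_eq_mul, map_smul, RingHom.id_apply]; ring

/-- The inclusion of the first column. -/
def column (x : Column q) : GluedAlg q := ⟨x.1, x.2.1, 0, x.2.2, 0, 0⟩

lemma column_injective : Function.Injective (column (q := q)) := fun _ _ h =>
  Prod.ext (congrArg a h) (Prod.ext (congrArg m h) (congrArg t h))

lemma mul_column (s : GluedAlg q) (x : Column q) : s * column x = column (columnEnd s x) := by
  ext1 <;> simp [column, columnEnd]

lemma column_add (x y : Column q) : column (x + y) = column x + column y := by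
  ext1 <;> simp [column]

lemma column_smul (r : k) (x : Column q) : column (r • x) = column x * inclV q r := by
  ext1 <;> simp [column, mul_comm]

/-- The module axioms for the column are the ring axioms of the glued algebra, pulled back along the
injection `column`. -/
lemma columnEnd_one : columnEnd (1 : GluedAlg q) = 1 :=
  LinearMap.ext fun x => column_injective (by rw [← mul_column, one_mul]; rfl)

lemma columnEnd_mul (s s' : GluedAlg q) : columnEnd (s * s') = columnEnd s * columnEnd s' :=
  LinearMap.ext fun x => column_injective (by
    rw [← mul_column, mul_assoc, mul_column, mul_column]; rfl)

lemma columnEnd_add (s s' : GluedAlg q) : columnEnd (s + s') = columnEnd s + columnEnd s' :=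
  LinearMap.ext fun x => column_injective (by
    rw [← mul_column, add_mul, mul_column, mul_column, ← column_add]; rfl)

lemma columnEnd_zero : columnEnd (0 : GluedAlg q) = 0 :=
  LinearMap.ext fun x => column_injective (by rw [← mul_column, zero_mul]; rfl)

lemma columnEnd_column (x : Column q) : columnEnd (column x) (1, 0, 0) = x := by
  refine Prod.ext ?_ (Prod.ext ?_ ?_) <;> simp [columnEnd, column]

lemma dual_column_apply (ρ : Module.Dual k (Column q)) (x : Column q) :
    ρ x = ρ (1, 0, 0) * x.1 + ρ (0, x.2.1, 0) + ρ (0, 0, 1) * x.2.2 := by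
  have h : x = x.1 • ((1, 0, 0) : Column q) + (0, x.2.1, 0) + x.2.2 • ((0, 0, 1) : Column q) := by
    refine Prod.ext ?_ (Prod.ext ?_ ?_) <;> simp
  conv_lhs => rw [h]
  simp only [map_add, map_smul, smul_eq_mul]
  ring

/-- The inclusion of the last row, which is the dual of the first column. -/
def row (ρ : Module.Dual k (Column q)) : GluedAlg q :=
  ⟨0, 0, 0, ρ (1, 0, 0),
    show Module.Dual k _ from ρ ∘ₗ LinearMap.inr k k _ ∘ₗ LinearMap.inl k _ k, ρ (0, 0, 1)⟩

lemma pairing_row (ρ : Module.Dual k (Column q)) (v : SpecialModule q q) :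
    pairing (row ρ).f v = ρ (0, v, 0) := rfl

lemma pairing_ext {f g : DualSpecialModule q q}
    (h : ∀ v, pairing f v = pairing g v) : f = g :=
  LinearMap.ext (f := (f : Module.Dual k (SpecialModule q q))) h

/-- This is the isomorphism of right modules `D(E e_V) ≅ e_W E`, on which both adjunctions for
coinduction rest. -/
lemma row_mul (ρ : Module.Dual k (Column q)) (s : GluedAlg q) :
    row ρ * s = row (ρ ∘ₗ columnEnd s) := by
  ext1
  · simp [row]
  · simp [row]
  · simp [row]
  · change ρ (1, 0, 0) * s.a + pairing (row ρ).f s.m + ρ (0, 0, 1) * s.t =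
      ρ (columnEnd s (1, 0, 0))
    rw [dual_column_apply ρ (columnEnd s (1, 0, 0)), pairing_row]
    simp [columnEnd]
  · refine pairing_ext fun v => ?_
    rw [pairing_row, mul_f, map_add, LinearMap.add_apply, pairing_op_smul, pairing_row,
      LinearMap.comp_apply, dual_column_apply ρ (columnEnd s (0, v, 0)), map_smul,
      LinearMap.smul_apply]
    simp [columnEnd, row]
  · change ρ (0, 0, 1) * s.c = ρ (columnEnd s (0, 0, 1))
    rw [dual_column_apply ρ (columnEnd s (0, 0, 1))]
    simp [columnEnd, show ((0, 0, 0) : Column q) = 0 from rfl]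

lemma row_add (ρ ρ' : Module.Dual k (Column q)) : row (ρ + ρ') = row ρ + row ρ' := by
  ext1 <;> try simp [row]
  rfl

lemma row_smul (r : k) (ρ : Module.Dual k (Column q)) : row (r • ρ) = inclW q r * row ρ := by
  ext1 <;> try simp [row]
  rfl

/-- The projection of the first column to its last coordinate. -/
def lastCoord : Module.Dual k (Column q) := LinearMap.snd k _ k ∘ₗ LinearMap.snd k k _

/-- Under the duality, `lastCoord` corresponds to `e_W`, which generates the last row; evaluation at
`lastCoord` is thus the counit of coinduction. -/
lemma lastCoord_comp_columnEnd_row (ρ : Module.Dual k (Column q)) :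
    lastCoord ∘ₗ columnEnd (row ρ) = ρ :=
  LinearMap.ext fun x => (dual_column_apply ρ x).symm

lemma row_lastCoord : row (lastCoord (q := q)) = inclW q 1 := by
  ext1 <;> try simp [row, lastCoord]
  rfl

lemma inclW_one_mul_row (ρ : Module.Dual k (Column q)) : inclW q 1 * row ρ = row ρ := by
  rw [← row_smul, one_smul]

end GluedAlg

end Glued

/-! ### Coinduction from the last row and its two adjoints -/

section Coinduction

variable {k : Type u} [Field k]

namespace GluedAlg

open Limits ModuleCat

variable (q : k)

instance : Module.Finite k (SpecialModule q q) := inferInstanceAs (Module.Finite k (Fin 3 → k))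

/-- The `k`-linear maps from the last row of the glued algebra to `U`. -/
def Coind (U : Type u) [AddCommGroup U] [Module k U] : Type u :=
  Module.Dual k (Column q) →ₗ[k] U

namespace Coind

variable {U : Type u} [AddCommGroup U] [Module k U]

instance : AddCommGroup (Coind q U) :=
  inferInstanceAs (AddCommGroup (Module.Dual k (Column q) →ₗ[k] U))

instance : FunLike (Coind q U) (Module.Dual k (Column q)) U :=
  inferInstanceAs (FunLike (Module.Dual k (Column q) →ₗ[k] U) _ _)

instance : LinearMapClass (Coind q U) k (Module.Dual k (Column q)) U :=
  inferInstanceAs (LinearMapClass (Module.Dual k (Column q) →ₗ[k] U) k _ _)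

variable {q}

@[ext] lemma ext {h h' : Coind q U} (H : ∀ ρ, h ρ = h' ρ) : h = h' := LinearMap.ext H

@[simp] lemma add_apply (h h' : Coind q U) (ρ : Module.Dual k (Column q)) :
    (h + h') ρ = h ρ + h' ρ := rfl

noncomputable instance : SMul (GluedAlg q) (Coind q U) where
  smul s h := LinearMap.comp (h : Module.Dual k (Column q) →ₗ[k] U) (columnEnd s).dualMap

lemma smul_apply (s : GluedAlg q) (h : Coind q U) (ρ : Module.Dual k (Column q)) :
    (s • h) ρ = h (ρ ∘ₗ columnEnd s) := rfl

noncomputable instance : Module (GluedAlg q) (Coind q U) where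
  one_smul h := by
    ext ρ
    rw [smul_apply, columnEnd_one]; rfl
  mul_smul s s' h := by
    ext ρ
    rw [smul_apply, columnEnd_mul]; rfl
  smul_zero s := rfl
  smul_add s h h' := rfl
  add_smul s s' h := by
    ext ρ
    rw [smul_apply, columnEnd_add, LinearMap.comp_add, map_add]; rfl
  zero_smul h := by
    ext ρ
    rw [smul_apply, columnEnd_zero, LinearMap.comp_zero, map_zero]; rfl

/-- The element `ρ ↦ ρ x • u`. -/
def tmul (x : Column q) (u : U) : Coind q U := (Module.Dual.eval k (Column q) x).smulRight u

@[simp] lemma tmul_apply (x : Column q) (u : U) (ρ : Module.Dual k (Column q)) :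
    tmul x u ρ = ρ x • u := rfl

lemma tmul_add (x : Column q) (u u' : U) : tmul x (u + u') = tmul x u + tmul x u' := by
  ext ρ
  simp

lemma tmul_smul (x : Column q) (r : k) (u : U) : tmul x (r • u) = tmul (r • x) u := by
  ext ρ
  simp [smul_smul, mul_comm]

lemma smul_tmul (s : GluedAlg q) (x : Column q) (u : U) :
    s • tmul x u = tmul (columnEnd s x) u := rfl

/-- Here finite-dimensionality of the column enters: expanding in dual bases identifies `Coind q U`
with the column tensored with `U`. -/
lemma sum_tmul (h : Coind q U) :
    ∑ j, tmul (Module.finBasis k (Column q) j) (h ((Module.finBasis k (Column q)).coord j)) = h := by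
  have (s : Finset (Fin (Module.finrank k (Column q)))) (F : _ → Coind q U)
      (ρ : Module.Dual k (Column q)) : (∑ j ∈ s, F j) ρ = ∑ j ∈ s, F j ρ :=
    LinearMap.sum_apply (R := k) (M := Module.Dual k (Column q)) s F ρ
  ext ρ
  rw [this]
  simp only [tmul_apply, ← map_smul, ← map_sum]
  rw [(Module.finBasis k (Column q)).sum_dual_apply_smul_coord]

end Coind

/-- The coinduction functor. -/
noncomputable def coindFunctor : ModuleCat.{u} k ⥤ ModuleCat.{u} (GluedAlg q) where
  obj U := ModuleCat.of _ (Coind q U)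
  map {U U'} g := ModuleCat.ofHom (X := Coind q U) (Y := Coind q U')
    { toFun h := g.hom ∘ₗ (h : Module.Dual k (Column q) →ₗ[k] U)
      map_add' _ _ := LinearMap.comp_add _ _ _
      map_smul' _ _ := rfl }

instance : (coindFunctor q).Additive where

variable {q} in
/-- Multiplication by elements of the last row. -/
noncomputable def rowAct {N : Type u} [AddCommGroup N] [Module (GluedAlg q) N] (n : N) :
    Module.Dual k (Column q) →ₗ[k] truncation (inclW q) N where
  toFun ρ := ⟨row ρ • n, by
    change inclW q 1 • row ρ • n = row ρ • n
    rw [← mul_smul, inclW_one_mul_row]⟩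
  map_add' ρ ρ' := Subtype.ext (by
    change row (ρ + ρ') • n = row ρ • n + row ρ' • n
    rw [row_add, add_smul])
  map_smul' r ρ := Subtype.ext (by
    change row (r • ρ) • n = inclW q r • row ρ • n
    rw [row_smul, mul_smul])

/-- Truncation at the coextension vertex is left adjoint to coinduction. -/
noncomputable def truncationAdjCoind : truncationFunctor (inclW q) ⊣ coindFunctor q :=
  Adjunction.mkOfHomEquiv
    { homEquiv N U :=
        { toFun g := ModuleCat.ofHom (Y := Coind q U)
            { toFun n := g.hom ∘ₗ rowAct n
              map_add' n n' := Coind.ext fun ρ => (congrArg g.hom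
                (Subtype.ext (smul_add (row ρ) n n'))).trans (g.hom.map_add _ _)
              map_smul' s n := Coind.ext fun ρ => congrArg g.hom (Subtype.ext (by
                change row ρ • s • n = row (ρ ∘ₗ columnEnd s) • n
                rw [← mul_smul, row_mul])) }
          invFun g := ModuleCat.ofHom (X := truncation (inclW q) N)
            { toFun n := (show Coind q U from g.hom n.1) lastCoord
              map_add' n n' := congrArg (fun h : Coind q U => h lastCoord)
                (g.hom.map_add n.1 n'.1)
              map_smul' r n := by
                have : (lastCoord ∘ₗ columnEnd (inclW q r) : Module.Dual k (Column q)) =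
                    r • lastCoord := by
                  rw [← mul_one r, map_mul, ← row_lastCoord, ← row_smul,
                    lastCoord_comp_columnEnd_row, mul_one]
                refine (congrArg (fun h : Coind q U => h lastCoord)
                  (g.hom.map_smul (inclW q r) n.1)).trans ?_
                exact (congrArg (show Coind q U from g.hom n.1) this).trans (map_smul _ _ _) }
          left_inv g := by
            ext n
            refine congrArg g.hom (Subtype.ext ?_)
            change row lastCoord • n.1 = n.1
            rw [row_lastCoord, truncation.one_smul_coe]
          right_inv g := by
            refine ModuleCat.hom_ext (LinearMap.ext fun n => Coind.ext (U := U) fun ρ => ?_)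
            refine (congrArg (fun h : Coind q U => h lastCoord)
              (g.hom.map_smul (row ρ) n)).trans ?_
            exact congrArg (show Coind q U from g.hom n) (lastCoord_comp_columnEnd_row ρ) }
      homEquiv_naturality_left_symm _ _ := rfl
      homEquiv_naturality_right _ _ := rfl }

variable {q} in
lemma sum_column_smul {N U : Type u} [AddCommGroup N] [Module (GluedAlg q) N] [AddCommGroup U]
    [Module k U] (g : U →ₗ[k] truncation (inclV q) N) (x : Column q) (u : U) :
    ∑ j, column (Module.finBasis k (Column q) j) •
      (g ((Module.finBasis k (Column q)).coord j x • u) : N) = column x • (g u : N) := by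
  have (r : k) (y : Column q) : column y • (g (r • u) : N) = column (r • y) • (g u : N) := by
    rw [map_smul, truncation.coe_smul, ← mul_smul, column_smul]
  simp only [this]
  rw [← Finset.sum_smul]
  congr 1
  refine (map_sum (AddMonoidHom.mk' column column_add) _ _).symm.trans (congrArg column ?_)
  exact (Module.finBasis k (Column q)).sum_repr x

variable {q} in
/-- The map `h ↦ ∑ xⱼ g(h(ξⱼ))` for dual bases `xⱼ` and `ξⱼ` of the first column and the last
row. -/
noncomputable def colAct {N U : Type u} [AddCommGroup N] [Module (GluedAlg q) N] [AddCommGroup U]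
    [Module k U] (g : U →ₗ[k] truncation (inclV q) N) : Coind q U →ₗ[GluedAlg q] N where
  toFun h := ∑ j, column (Module.finBasis k (Column q) j) •
    (g (h ((Module.finBasis k (Column q)).coord j)) : N)
  map_add' h h' := by
    simp only [Coind.add_apply, map_add, AddSubgroup.coe_add, smul_add, Finset.sum_add_distrib]
  map_smul' s h := by
    -- Expanding `ξⱼ ∘ s` in the dual basis and exchanging the sums turns the left side into `∑ᵢ (s
    -- xᵢ) g(h(ξᵢ))`, by `sum_column_smul`.
    have h₁ (j) : (s • h) ((Module.finBasis k (Column q)).coord j) =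
        ∑ i, (Module.finBasis k (Column q)).coord j
          (columnEnd s (Module.finBasis k (Column q) i)) •
            h ((Module.finBasis k (Column q)).coord i) := by
      rw [Coind.smul_apply, ← (Module.finBasis k (Column q)).sum_dual_apply_smul_coord
        ((Module.finBasis k (Column q)).coord j ∘ₗ columnEnd s), map_sum]
      exact Finset.sum_congr rfl fun i _ => map_smul h _ _
    simp only [h₁, map_sum, AddSubgroup.val_finsetSum, Finset.smul_sum]
    rw [Finset.sum_comm]
    refine Finset.sum_congr rfl fun i _ => ?_
    rw [sum_column_smul, ← mul_column, mul_smul, RingHom.id_apply]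

lemma columnEnd_inclV (r : k) : columnEnd (inclV q r) (1, 0, 0) = r • (1, 0, 0) := by
  refine Prod.ext ?_ (Prod.ext ?_ ?_) <;> simp [columnEnd]

/-- Coinduction is left adjoint to truncation at the extension vertex. -/
noncomputable def coindAdjTruncation : coindFunctor q ⊣ truncationFunctor (inclV q) :=
  Adjunction.mkOfHomEquiv
    { homEquiv U N :=
        { toFun g := ModuleCat.ofHom (Y := truncation (inclV q) N)
            { toFun u := ⟨g.hom (Coind.tmul (1, 0, 0) u : Coind q U), by
                refine (g.hom.map_smul (inclV q 1) _).symm.trans (congrArg g.hom ?_)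
                exact (Coind.smul_tmul _ _ _).trans (by rw [columnEnd_inclV, one_smul])⟩
              map_add' u u' := Subtype.ext ((congrArg g.hom (Coind.tmul_add _ u u')).trans
                (g.hom.map_add _ _))
              map_smul' r u := Subtype.ext ((congrArg g.hom (by
                rw [Coind.tmul_smul, ← columnEnd_inclV]; rfl)).trans
                  (g.hom.map_smul (inclV q r) (Coind.tmul (1, 0, 0) u : Coind q U))) }
          invFun g := ModuleCat.ofHom (X := Coind q U) (colAct g.hom)
          left_inv g := by
            ext h
            let b := Module.finBasis k (Column q)
            change ∑ j, column (b j) • g.hom (Coind.tmul (1, 0, 0) ((h : Coind q U) (b.coord j)) :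
              Coind q U) = g.hom h
            refine Eq.trans ?_ (congrArg g.hom (Coind.sum_tmul h))
            refine Eq.trans ?_ (map_sum g.hom _ _).symm
            refine Finset.sum_congr rfl fun j _ => ?_
            refine (g.hom.map_smul (column (b j)) _).symm.trans (congrArg g.hom ?_)
            exact (Coind.smul_tmul _ _ _).trans (by rw [columnEnd_column])
          right_inv g := by
            ext u
            exact (sum_column_smul g.hom (1, 0, 0) u).trans (g.hom u).2 }
      homEquiv_naturality_left_symm _ _ := rfl
      homEquiv_naturality_right _ _ := rfl }

/-- This amounts to `e_V E e_V = k`, and yields full faithfulness of coinduction. -/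
instance (U : ModuleCat.{u} k) : IsIso ((coindAdjTruncation q).unit.app U) := by
  rw [ConcreteCategory.isIso_iff_bijective]
  have h (u : U) : ((coindAdjTruncation q).unit.app U u : truncation (inclV q) (Coind q U)).1 =
      Coind.tmul (1, 0, 0) u := rfl
  constructor
  · intro u u' H
    have := congrArg (fun x : truncation (inclV q) (Coind q U) =>
      (show Coind q U from x.1) (LinearMap.fst k k _)) H
    simpa [h] using this
  · intro (n : truncation (inclV q) (Coind q U))
    -- If `e_V n = n`, then `n ρ = n (ρ ∘ e_V)`, and `ρ ∘ e_V` is `ρ (1, 0, 0)` times the first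
    -- coordinate; so `n` is determined by its value there.
    refine ⟨(show Coind q U from n.1) (LinearMap.fst k k _), Subtype.ext ?_⟩
    refine (h _).trans (Eq.trans (Coind.ext fun ρ => ?_) n.2)
    rw [Coind.tmul_apply, Coind.smul_apply, ← map_smul]
    congr 1
    refine LinearMap.ext fun x => ?_
    have : columnEnd (inclV q 1) x = x.1 • (1, 0, 0) := by
      refine Prod.ext ?_ (Prod.ext ?_ ?_) <;> simp [columnEnd]
    rw [LinearMap.comp_apply, this, map_smul]
    simp [mul_comm]

end GluedAlg

end Coinduction

/-! ### The derived equivalence of `B` and `C` -/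

section DerivedEquivalence

open Limits ModuleCat GluedAlg

variable {k : Type u} [Field k] (q : k)

instance : PreservesFiniteLimits (coindFunctor q) :=
  have := (truncationAdjCoind q).rightAdjoint_preservesLimits
  ⟨fun _ => inferInstance⟩

instance : PreservesFiniteColimits (coindFunctor q) :=
  have := (coindAdjTruncation q).leftAdjoint_preservesColimits
  ⟨fun _ => inferInstance⟩

/-- The one-point extension `B` and the one-point coextension `C` are derived equivalent, for every
parameter `q`: both `D(B)` and `D(C)` embed in the derived category of the glued algebra, as the
left and the right orthogonal of the image of coinduction. -/
theorem derivedEquivalent_algB_algC [HasDerivedCategory.{w} (ModuleCat.{u} (AlgB q))]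
    [HasDerivedCategory.{w'} (ModuleCat.{u} (AlgC q))] :
    DerivedEquivalent.{w, w'} (AlgB q) (AlgC q) := by
  let _ : HasDerivedCategory.{u + 1} (ModuleCat.{u} (GluedAlg q)) := .standard _
  let _ : HasDerivedCategory.{u + 1} (ModuleCat.{u} k) := .standard _
  have hB : Function.LeftInverse (projB q) (inclB q) := fun _ => rfl
  have hC : Function.LeftInverse (projC q) (inclC q) := fun _ => rfl
  have := preservesFiniteLimits_restrictScalars (π := projB q)
  have := preservesFiniteColimits_restrictScalars (π := projB q)
  have := preservesFiniteLimits_restrictScalars (π := projC q)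
  have := preservesFiniteColimits_restrictScalars (π := projC q)
  have := restrictScalars_full_of_surjective hB.surjective
  have := restrictScalars_full_of_surjective hC.surjective
  have : IsIso (coindAdjTruncation q).unit := NatIso.isIso_of_isIso_app _
  have hr := (coindAdjTruncation q).fullyFaithfulLOfIsIsoUnit
  have := hr.full
  have := hr.faithful
  exact exists_bounded_derived_equivalence
    (truncationAdjRestrictScalars hB (inclB_one_mul q))
    (restrictScalarsAdjTruncation hC (mul_inclC_one q))
    (truncationAdjCoind q) (coindAdjTruncation q)
    -- `e_W` maps to zero in `B` and `e_V` maps to zero in `C`; the remaining two conditions come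
    -- from `e_V + e_C = 1 = e_W + e_B`.
    (isZero_truncation_restrictScalars rfl) (isZero_truncation_restrictScalars rfl)
    (isZero_of_isZero_truncation (inclV_one_add_inclC_one q))
    (isZero_of_isZero_truncation (inclW_one_add_inclB_one q))

end DerivedEquivalence

theorem mainTheorem2 {k : Type u} [Field k] (q : k) (hq₀ : q ≠ 0)
    (hq : ∀ n : ℕ, 1 ≤ n → q ^ n ≠ 1)
    [HasDerivedCategory.{w} (ModuleCat.{u} (AlgB q))]
    [HasDerivedCategory.{w'} (ModuleCat.{u} (AlgC q))] :
    DerivedEquivalent.{w, w'} (AlgB q) (AlgC q) :=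
  derivedEquivalent_algB_algC q
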